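/- A convex body in $\mathbb{R}^n$ is a compact convex set with non-empty interior; it is centrally symmetric if $-K=K$. For a centrally symmetric convex body $K$ let $\|x\|_K=\inf\{r>0: x\in rK\}$. For a convex body $C$, $s\geqslant 1$ and ${\bf t}=(t_1,\ldots,t_s)\in\mathbb{R}^s$ set $$\|{\bf t}\|_{C^s,K}=\frac{1}{{\rm vol}_n(C)^s}\int_{C}\cdots\int_{C}\Big\|\sum_{j=1}^s t_jx_j\Big\|_K\,dx_1\cdots dx_s .$$ A convex body $C$ is isotropic, with isotropic constant $L_C>0$, if ${\rm vol}_n(C)=1$, its barycenter is at the origin and $\int_C\langle x,\xi\rangle^2dx=L_C^2$ for every Euclidean unit vector $\xi$. A centrally symmetric convex body $K$ is $2$-convex with constant $\alpha>0$ if, for every $\varepsilon\in(0,2]$, $$\inf\Big\{1-\Big\|\frac{x+y}{2}\Big\|_K:\ \|x\|_K\leqslant 1,\ \|y\|_K\leqslant 1,\ \|x-y\|_K\geqslant\varepsilon\Big\}\geqslant\alpha\varepsilon^2 .$$ Theorem. There exists an absolute constant $c>0$ such that the following hold. (1) If $C$ is an isotropic convex body in $\mathbb{R}^n$ and $K$ is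 an isotropic centrally symmetric convex body in $\mathbb{R}^n$ which is $2$-convex with constant $\alpha$, then for every $s\geqslant 1$ and ${\bf t}\in\mathbb{R}^s$, $$\|{\bf t}\|_{C^s,K}\leqslant\frac{cL_C}{\sqrt{\alpha}}\,\|{\bf t}\|_2 .$$ (2) If $K$ is any centrally symmetric convex body in $\mathbb{R}^n$ which is $2$-convex with constant $\alpha$, then for every $s\geqslant 1$ and ${\bf t}\in\mathbb{R}^s$, $$\|{\bf t}\|_{K^s,K}\leqslant\frac{c}{\alpha}\,\|{\bf t}\|_2 .$$ -/

import Mathlib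

open MeasureTheory
open scoped Pointwise BigOperators

/-- A convex body in `ℝⁿ`: a compact convex set with non-empty interior. -/
structure IsConvexBody {n : ℕ} (C : Set (EuclideanSpace ℝ (Fin n))) : Prop where
  convex : Convex ℝ C
  isCompact : IsCompact C
  interior_nonempty : (interior C).Nonempty

/-- A centrally symmetric convex body: a convex body `K` with `-K = K`. -/
structure IsSymmConvexBody {n : ℕ} (K : Set (EuclideanSpace ℝ (Fin n))) : Prop
    extends IsConvexBody K where
  neg_eq : -K = K

/-- `C` is an isotropic convex body in `ℝⁿ` and its isotropic constant is `L`: it is a convex body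
of volume `1` with barycentre at the origin, and `∫_C ⟨x, ξ⟩² dx = L²` for every unit vector `ξ`,
where `L > 0`. -/
structure IsIsotropicWith {n : ℕ} (C : Set (EuclideanSpace ℝ (Fin n))) (L : ℝ) : Prop
    extends IsConvexBody C where
  volume_eq_one : volume C = 1
  barycenter_eq_zero : ∫ x in C, x = 0
  const_pos : 0 < L
  integral_inner_sq : ∀ ξ : EuclideanSpace ℝ (Fin n), ‖ξ‖ = 1 → ∫ x in C, (inner ℝ x ξ) ^ 2 = L ^ 2

/-- `C` is an isotropic convex body. -/
def IsIsotropic {n : ℕ} (C : Set (EuclideanSpace ℝ (Fin n))) : Prop :=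
  ∃ L : ℝ, IsIsotropicWith C L

/-- The modulus of convexity of `K`:
`δ_K(ε) = inf {1 - ‖(x + y)/2‖_K : ‖x‖_K ≤ 1, ‖y‖_K ≤ 1, ‖x - y‖_K ≥ ε}`,
where `‖·‖_K` is the gauge function of `K`. -/
noncomputable def modulusOfConvexity {n : ℕ} (K : Set (EuclideanSpace ℝ (Fin n))) (ε : ℝ) : ℝ :=
  sInf {r : ℝ | ∃ x y : EuclideanSpace ℝ (Fin n), gauge K x ≤ 1 ∧ gauge K y ≤ 1 ∧
    ε ≤ gauge K (x - y) ∧ r = 1 - gauge K ((1 / 2 : ℝ) • (x + y))}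

/-- `K` is `2`-convex with constant `α > 0`: `δ_K(ε) ≥ α ε²` for every `ε ∈ (0, 2]`. -/
structure IsTwoConvexWith {n : ℕ} (K : Set (EuclideanSpace ℝ (Fin n))) (α : ℝ) : Prop where
  const_pos : 0 < α
  le_modulus : ∀ ε : ℝ, 0 < ε → ε ≤ 2 → α * ε ^ 2 ≤ modulusOfConvexity K ε

/-- `‖t‖_{𝒞,K} = (∏ vol(C_j))⁻¹ ∫_{C_1} ⋯ ∫_{C_s} ‖∑ t_j x_j‖_K dx_1 ⋯ dx_s`
for `𝒞 = (C_1, …, C_s)`. -/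
noncomputable def bodyNorm {n s : ℕ} (C : Fin s → Set (EuclideanSpace ℝ (Fin n)))
    (K : Set (EuclideanSpace ℝ (Fin n))) (t : EuclideanSpace ℝ (Fin s)) : ℝ :=
  (∏ j, volume.real (C j))⁻¹ *
    ∫ x : Fin s → EuclideanSpace ℝ (Fin n) in Set.univ.pi C, gauge K (∑ j, t j • x j)

open scoped ENNReal

/-! Everything reduces to a second moment bound. If `θ` has dual norm at most `1`, points of the cap
`{x ∈ K | t ≤ ⟨θ, x⟩}` and of its reflection are at `K`-distance at least `2t`, so 2-convexity puts
their midpoints in `(1 - 4αt²)K`. Brunn–Minkowski bounds the cap's proportion of volume by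
`exp(-4nαt²)`, and integration gives `E⟨θ, x⟩² ≤ 1/(2nα)` (`integral_inner_sq_le`).

By duality, `gauge K x ^ 2 ≤ (2nα)⁻¹ ∑ ⟨v i, x⟩²` for a basis `v` orthonormal for the covariance of
`K` (`gauge_sq_le`). Averaged over independent centred points of `C`, the cross terms vanish, and
the sum over `n` coordinates cancels the `1/n` (`bodyNorm_sq_le`).

For `C = K` each coordinate has variance `1`, giving order `α^(-1/2)`, which is at most order `1/α`
as `α ≤ 1/4`. For isotropic `C` and `K` the variance is `L_C²/L_K²`, and `L_K` has an absolute lower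
bound (`one_le_const_sq`). -/

/-! ### Prékopa–Leindler and Brunn–Minkowski at the midpoint. -/

lemma volume_add_volume_le_of_isCompact {A B S : Set ℝ} (hA : IsCompact A) (hB : IsCompact B)
    (hA' : A.Nonempty) (hB' : B.Nonempty)
    (h : ∀ x ∈ A, ∀ y ∈ B, (1 / 2 : ℝ) • (x + y) ∈ S) :
    volume A + volume B ≤ 2 * volume S := by
  obtain ⟨a, haA, ha⟩ := hA.exists_isGreatest hA'
  obtain ⟨b, hbB, hb⟩ := hB.exists_isLeast hB'
  have h1 : volume ((fun x => b + x) '' A) = volume A := by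
    rw [Set.image_add_left, measure_preimage_add]
  have h2 : volume ((fun x => a + x) '' B) = volume B := by
    rw [Set.image_add_left, measure_preimage_add]
  -- With `a = max A` and `b = min B`, both translates lie in `A + B` and meet only at `a + b`.
  have hsub : (fun x => b + x) '' A ∪ (fun x => a + x) '' B ⊆ (2 : ℝ) • S := by
    rintro _ (⟨x, hx, rfl⟩ | ⟨y, hy, rfl⟩)
    · refine ⟨_, h x hx b hbB, ?_⟩
      simp only [smul_eq_mul]; ring
    · refine ⟨_, h a haA y hy, ?_⟩
      simp only [smul_eq_mul]; ring
  have hint : volume ((fun x => b + x) '' A ∩ (fun x => a + x) '' B) = 0 := by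
    refine measure_mono_null (t := {a + b}) ?_ (by simp)
    rintro _ ⟨⟨x, hx, rfl⟩, ⟨y, hy, hxy⟩⟩
    have := ha hx
    have := hb hy
    simp only [Set.mem_singleton_iff] at *
    linarith
  have hBm : MeasurableSet ((fun x => a + x) '' B) :=
    (hB.image (continuous_const.add continuous_id)).measurableSet
  calc volume A + volume B
      = volume ((fun x => b + x) '' A ∪ (fun x => a + x) '' B) := by
        rw [← h1, ← h2, ← measure_union_add_inter _ hBm, hint, add_zero]
    _ ≤ volume ((2 : ℝ) • S) := measure_mono hsub
    _ = 2 * volume S := by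
        rw [Measure.addHaar_smul]; simp

lemma volume_add_volume_le {A B S : Set ℝ} (hA : MeasurableSet A) (hB : MeasurableSet B)
    (hA' : A.Nonempty) (hB' : B.Nonempty)
    (h : ∀ x ∈ A, ∀ y ∈ B, (1 / 2 : ℝ) • (x + y) ∈ S) :
    volume A + volume B ≤ 2 * volume S := by
  obtain ⟨a, ha⟩ := hA'
  obtain ⟨b, hb⟩ := hB'
  have key : ∀ K ⊆ A, IsCompact K → ∀ L ⊆ B, IsCompact L →
      volume K + volume L ≤ 2 * volume S := by
    intro K hKA hK L hLB hL
    -- The approximating compact sets may be empty; inserting `a` and `b` makes the compact case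
    -- applicable.
    refine (add_le_add (measure_mono (Set.subset_insert a K))
      (measure_mono (Set.subset_insert b L))).trans ?_
    refine volume_add_volume_le_of_isCompact (hK.insert a) (hL.insert b)
      (Set.insert_nonempty _ _) (Set.insert_nonempty _ _) ?_
    intro x hx y hy
    exact h x (Set.insert_subset ha hKA hx) y (Set.insert_subset hb hLB hy)
  rw [hA.measure_eq_iSup_isCompact volume, hB.measure_eq_iSup_isCompact volume]
  simp only [iSup_and']
  exact ENNReal.biSup_add_biSup_le' ⟨∅, Set.empty_subset _, isCompact_empty⟩
    ⟨∅, Set.empty_subset _, isCompact_empty⟩ fun K hK L hL => key K hK.1 hK.2 L hL.1 hL.2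

lemma four_mul_le_sq_of_add_le {a b c : ℝ≥0∞} (h : a + b ≤ 2 * c) : a * b ≤ c ^ 2 := by
  rcases eq_or_ne c ∞ with rfl | hc
  · simp
  have hab : a + b ≠ ∞ := ne_top_of_le_ne_top (by finiteness) h
  have ha : a ≠ ∞ := ne_top_of_le_ne_top hab le_self_add
  have hb : b ≠ ∞ := ne_top_of_le_ne_top hab le_add_self
  lift a to NNReal using ha
  lift b to NNReal using hb
  lift c to NNReal using hc
  norm_cast at h ⊢
  have h' : (a : ℝ) + b ≤ 2 * c := by exact_mod_cast h
  have : (a : ℝ) * b ≤ c ^ 2 := by nlinarith [sq_nonneg ((a : ℝ) - b), a.2, b.2, c.2]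
  exact_mod_cast this

/-- Layer cake: equal suprema make the superlevel sets of `f` and `g` nonempty for the same `t < 1`,
so one-dimensional Brunn–Minkowski applies level by level. -/
lemma lintegral_add_lintegral_le_of_iSup_eq_one {f g h : ℝ → ℝ≥0∞} (hf : Measurable f)
    (hg : Measurable g) (hh : Measurable h) (hf1 : (⨆ x, f x) = 1) (hg1 : (⨆ x, g x) = 1)
    (hfg : ∀ x y, f x * g y ≤ h ((1 / 2 : ℝ) • (x + y)) ^ 2) :
    (∫⁻ x, f x) + ∫⁻ x, g x ≤ 2 * ∫⁻ x, h x := by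
  have hfl : ∀ x, f x ≤ 1 := fun x => hf1 ▸ le_iSup f x
  have hgl : ∀ x, g x ≤ 1 := fun x => hg1 ▸ le_iSup g x
  have layer : ∀ u : ℝ → ℝ≥0∞, Measurable u → (∀ x, u x ≤ 1) →
      ∫⁻ x, u x = ∫⁻ t in Set.Ioi (0 : ℝ), volume {x | ENNReal.ofReal t < u x} := by
    intro u hu hu1
    have hne : ∀ x, u x ≠ ∞ := fun x => ne_top_of_le_ne_top ENNReal.one_ne_top (hu1 x)
    have := lintegral_eq_lintegral_meas_lt volume (f := fun x => (u x).toReal)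
      (Filter.Eventually.of_forall fun x => ENNReal.toReal_nonneg) hu.ennreal_toReal.aemeasurable
    simp only [ENNReal.ofReal_toReal (hne _)] at this
    rw [this]
    refine setLIntegral_congr_fun measurableSet_Ioi fun t ht => ?_
    congr 1
    ext x
    exact (ENNReal.ofReal_lt_iff_lt_toReal (le_of_lt ht) (hne x)).symm
  have hmin : ∫⁻ x, min (h x) 1 ≤ ∫⁻ x, h x := lintegral_mono fun x => min_le_left _ _
  refine le_trans ?_ (mul_le_mul_right hmin 2)
  rw [layer f hf hfl, layer g hg hgl,
    layer (fun x => min (h x) 1) (hh.min measurable_const) (fun x => min_le_right _ _)]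
  refine (le_lintegral_add _ _).trans ?_
  rw [← lintegral_const_mul' _ _ (by simp)]
  refine setLIntegral_mono' measurableSet_Ioi fun t ht => ?_
  rcases lt_or_ge (ENNReal.ofReal t) 1 with h1 | h1
  · refine volume_add_volume_le (measurableSet_lt measurable_const hf)
      (measurableSet_lt measurable_const hg) ?_ ?_ ?_
    · exact lt_iSup_iff.mp (hf1 ▸ h1)
    · exact lt_iSup_iff.mp (hg1 ▸ h1)
    · intro x hx y hy
      refine lt_min ?_ h1
      by_contra! hle
      refine absurd (hfg x y) (not_le.mpr ?_)
      calc h ((1 / 2 : ℝ) • (x + y)) ^ 2 ≤ ENNReal.ofReal t ^ 2 := by gcongr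
        _ = ENNReal.ofReal t * ENNReal.ofReal t := sq _
        _ < f x * g y := ENNReal.mul_lt_mul hx hy
  · have e1 : {x | ENNReal.ofReal t < f x} = ∅ := by
      ext x; simpa using (hfl x).trans h1
    have e2 : {x | ENNReal.ofReal t < g x} = ∅ := by
      ext x; simpa using (hgl x).trans h1
    simp [e1, e2]

lemma lintegral_mul_lintegral_le_of_iSup_ne_top {f g h : ℝ → ℝ≥0∞} (hf : Measurable f)
    (hg : Measurable g) (hh : Measurable h) (hf1 : (⨆ x, f x) ≠ ∞) (hg1 : (⨆ x, g x) ≠ ∞)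
    (hfg : ∀ x y, f x * g y ≤ h ((1 / 2 : ℝ) • (x + y)) ^ 2) :
    (∫⁻ x, f x) * ∫⁻ x, g x ≤ (∫⁻ x, h x) ^ 2 := by
  set M := ⨆ x, f x with hM
  set N := ⨆ x, g x with hN
  rcases eq_or_ne M 0 with h0 | hM0
  · have : f = 0 := by
      ext x; simpa using (le_iSup f x).trans h0.le
    simp [this]
  rcases eq_or_ne N 0 with h0 | hN0
  · have : g = 0 := by
      ext x; simpa using (le_iSup g x).trans h0.le
    simp [this]
  -- Dividing `f`, `g`, `h` by `M`, `N`, `√(MN)` preserves the hypothesis; AM–GM then turns the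
  -- additive inequality into the product form.
  set c : ℝ≥0∞ := (M * N) ^ (1 / 2 : ℝ) with hc
  have hc2 : c ^ 2 = M * N := by
    rw [hc, ← ENNReal.rpow_natCast, ← ENNReal.rpow_mul]; norm_num
  have key := lintegral_add_lintegral_le_of_iSup_eq_one (f := fun x => M⁻¹ * f x)
    (g := fun x => N⁻¹ * g x) (h := fun x => c⁻¹ * h x) (hf.const_mul _) (hg.const_mul _)
    (hh.const_mul _) (by rw [← ENNReal.mul_iSup, ENNReal.inv_mul_cancel hM0 hf1])
    (by rw [← ENNReal.mul_iSup, ENNReal.inv_mul_cancel hN0 hg1]) (by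
      intro x y
      rw [mul_pow, ← ENNReal.inv_pow, hc2, ENNReal.mul_inv (.inl hM0) (.inl hf1)]
      calc M⁻¹ * f x * (N⁻¹ * g y) = M⁻¹ * N⁻¹ * (f x * g y) := by ring
        _ ≤ _ := by gcongr; exact hfg x y)
  have key2 := four_mul_le_sq_of_add_le key
  rw [lintegral_const_mul _ hf, lintegral_const_mul _ hg, lintegral_const_mul _ hh, mul_pow,
    ← ENNReal.inv_pow, hc2, ENNReal.mul_inv (.inl hM0) (.inl hf1)] at key2
  have key3 : (M * M⁻¹) * (N * N⁻¹) * ((∫⁻ x, f x) * ∫⁻ x, g x) ≤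
      (M * M⁻¹) * (N * N⁻¹) * (∫⁻ x, h x) ^ 2 := by
    calc _ = M * N * (M⁻¹ * (∫⁻ x, f x) * (N⁻¹ * ∫⁻ x, g x)) := by ring
      _ ≤ M * N * (M⁻¹ * N⁻¹ * (∫⁻ x, h x) ^ 2) := by gcongr
      _ = _ := by ring
  simpa [ENNReal.mul_inv_cancel hM0 hf1, ENNReal.mul_inv_cancel hN0 hg1] using key3

/-- The one-dimensional Prékopa–Leindler inequality at the midpoint. -/
lemma prekopa_leindler_real {f g h : ℝ → ℝ≥0∞} (hf : Measurable f)
    (hg : Measurable g) (hh : Measurable h)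
    (hfg : ∀ x y, f x * g y ≤ h ((1 / 2 : ℝ) • (x + y)) ^ 2) :
    (∫⁻ x, f x) * ∫⁻ x, g x ≤ (∫⁻ x, h x) ^ 2 := by
  -- Truncating `f` and `g` makes their suprema finite and only weakens the demand on `h`.
  have trunc : ∀ u : ℝ → ℝ≥0∞, Measurable u → ∫⁻ x, u x = ⨆ k : ℕ, ∫⁻ x, min (u x) k := by
    intro u hu
    rw [← lintegral_iSup (fun k => hu.min measurable_const)
      (fun i j hij x => min_le_min_left _ (by exact_mod_cast hij))]
    congr 1 with x
    change _ = ⨆ k : ℕ, u x ⊓ k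
    rw [← inf_iSup_eq, ENNReal.iSup_natCast, inf_top_eq]
  have bdd : ∀ (u : ℝ → ℝ≥0∞) (k : ℕ), (⨆ x, min (u x) k) ≠ ∞ := fun u k =>
    ne_top_of_le_ne_top (ENNReal.natCast_ne_top k) (iSup_le fun x => min_le_right _ _)
  rw [trunc f hf, trunc g hg]
  simp only [ENNReal.iSup_mul, ENNReal.mul_iSup]
  exact iSup_le fun i => iSup_le fun j =>
    lintegral_mul_lintegral_le_of_iSup_ne_top (hf.min measurable_const)
      (hg.min measurable_const) hh (bdd f _) (bdd g _)
      fun x y => (mul_le_mul' (min_le_left _ _) (min_le_left _ _)).trans (hfg x y)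

/-- The Prékopa–Leindler inequality at the midpoint. -/
lemma prekopa_leindler_pi (n : ℕ) {f g h : (Fin n → ℝ) → ℝ≥0∞} (hf : Measurable f)
    (hg : Measurable g) (hh : Measurable h)
    (hfg : ∀ x y, f x * g y ≤ h ((1 / 2 : ℝ) • (x + y)) ^ 2) :
    (∫⁻ x, f x) * ∫⁻ x, g x ≤ (∫⁻ x, h x) ^ 2 := by
  induction n with
  | zero =>
    simp only [lintegral_unique]
    have hv : (volume : Measure (Fin 0 → ℝ)) Set.univ = 1 := by simp [volume_pi]
    simp only [hv, mul_one]
    have := hfg default default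
    rw [Subsingleton.elim ((1 / 2 : ℝ) • (default + default)) (default : Fin 0 → ℝ)] at this
    convert this
  | succ n ih =>
    let e := MeasurableEquiv.piFinSuccAbove (fun _ : Fin (n + 1) => ℝ) 0
    have he : ∀ p q : ℝ × (Fin n → ℝ),
        e.symm ((1 / 2 : ℝ) • (p + q)) = (1 / 2 : ℝ) • (e.symm p + e.symm q) := by
      intro p q
      ext i
      refine Fin.cases ?_ (fun j => ?_) i <;>
        simp [e, MeasurableEquiv.piFinSuccAbove, Fin.insertNthEquiv, mul_add]
    have fub : ∀ u : (Fin (n + 1) → ℝ) → ℝ≥0∞, Measurable u →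
        ∫⁻ x, u x = ∫⁻ a, ∫⁻ z, u (e.symm (a, z)) := by
      intro u hu
      have hmp := (volume_preserving_piFinSuccAbove (fun _ : Fin (n + 1) => ℝ) 0).symm
      rw [← hmp.lintegral_comp hu, Measure.volume_eq_prod, lintegral_prod]
      exact (hu.comp e.symm.measurable).aemeasurable
    have hm : ∀ u : (Fin (n + 1) → ℝ) → ℝ≥0∞, Measurable u →
        Measurable fun p : ℝ × (Fin n → ℝ) => u (e.symm p) :=
      fun u hu => hu.comp e.symm.measurable
    rw [fub f hf, fub g hg, fub h hh]
    -- The induction hypothesis on slices says that the marginals satisfy the one-dimensional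
    -- hypothesis.
    refine prekopa_leindler_real (hm f hf).lintegral_prod_right' (hm g hg).lintegral_prod_right'
      (hm h hh).lintegral_prod_right' fun a b => ?_
    refine ih ((hm f hf).comp measurable_prodMk_left) ((hm g hg).comp measurable_prodMk_left)
      ((hm h hh).comp measurable_prodMk_left) fun x y => ?_
    have := hfg (e.symm (a, x)) (e.symm (b, y))
    rw [← he] at this
    exact this

/-- The multiplicative Brunn–Minkowski inequality at the midpoint. -/
lemma volume_mul_volume_le_sq {n : ℕ} {A B S : Set (EuclideanSpace ℝ (Fin n))}
    (hA : MeasurableSet A) (hB : MeasurableSet B) (hS : MeasurableSet S)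
    (h : ∀ x ∈ A, ∀ y ∈ B, (1 / 2 : ℝ) • (x + y) ∈ S) :
    volume A * volume B ≤ volume S ^ 2 := by
  have hmp := EuclideanSpace.volume_preserving_symm_measurableEquiv_toLp (Fin n)
  let e := (MeasurableEquiv.toLp 2 (Fin n → ℝ))
  have hv : ∀ T : Set (EuclideanSpace ℝ (Fin n)), MeasurableSet T →
      volume T = ∫⁻ x, (e ⁻¹' T).indicator 1 x := by
    intro T hT
    rw [lintegral_indicator_one (e.measurable hT)]
    exact (hmp.symm.measure_preimage hT.nullMeasurableSet).symm
  rw [hv A hA, hv B hB, hv S hS]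
  refine prekopa_leindler_pi n (measurable_one.indicator (e.measurable hA))
    (measurable_one.indicator (e.measurable hB)) (measurable_one.indicator (e.measurable hS)) ?_
  intro x y
  by_cases hx : x ∈ e ⁻¹' A
  · by_cases hy : y ∈ e ⁻¹' B
    · have : (1 / 2 : ℝ) • (x + y) ∈ e ⁻¹' S := h _ hx _ hy
      rw [Set.indicator_of_mem hx, Set.indicator_of_mem hy, Set.indicator_of_mem this]
      simp
    · simp [Set.indicator_of_notMem hy]
  · simp [Set.indicator_of_notMem hx]
-- Convex bodies and their gauges.
lemma IsConvexBody.volume_ne_zero {n : ℕ} {K : Set (EuclideanSpace ℝ (Fin n))}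
    (hK : IsConvexBody K) : volume K ≠ 0 :=
  (Measure.measure_pos_of_nonempty_interior _ hK.interior_nonempty).ne'

lemma IsConvexBody.volume_ne_top {n : ℕ} {K : Set (EuclideanSpace ℝ (Fin n))}
    (hK : IsConvexBody K) : volume K ≠ ∞ :=
  hK.isCompact.measure_ne_top

namespace IsSymmConvexBody

variable {n : ℕ} {K : Set (EuclideanSpace ℝ (Fin n))}

lemma neg_mem (hK : IsSymmConvexBody K) {x : EuclideanSpace ℝ (Fin n)} (hx : x ∈ K) : -x ∈ K := by
  rw [← hK.neg_eq]; simpa using hx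

lemma mem_nhds_zero (hK : IsSymmConvexBody K) : K ∈ nhds 0 := by
  obtain ⟨x, hx⟩ := hK.interior_nonempty
  have hx' : -x ∈ interior K := by
    have h : (Homeomorph.neg (EuclideanSpace ℝ (Fin n))) ⁻¹' interior K = interior K := by
      rw [Homeomorph.preimage_interior]
      congr 1
      exact hK.neg_eq
    rw [← h]
    simpa using hx
  have := hK.convex.interior hx hx' (a := 1 / 2) (b := 1 / 2) (by norm_num) (by norm_num)
    (by norm_num)
  simp only [smul_neg, add_neg_cancel] at this
  exact mem_interior_iff_mem_nhds.mp this

lemma absorbent (hK : IsSymmConvexBody K) : Absorbent ℝ K :=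
  absorbent_nhds_zero hK.mem_nhds_zero

lemma gauge_neg (hK : IsSymmConvexBody K) (x : EuclideanSpace ℝ (Fin n)) :
    gauge K (-x) = gauge K x :=
  _root_.gauge_neg (fun _ => hK.neg_mem) x

lemma gauge_add_le (hK : IsSymmConvexBody K) (x y : EuclideanSpace ℝ (Fin n)) :
    gauge K (x + y) ≤ gauge K x + gauge K y :=
  _root_.gauge_add_le hK.convex hK.absorbent x y

lemma continuous_gauge (hK : IsSymmConvexBody K) : Continuous (gauge K) :=
  _root_.continuous_gauge hK.convex hK.mem_nhds_zero

lemma gauge_le_iff (hK : IsSymmConvexBody K) {r : ℝ} (hr : 0 ≤ r)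
    {x : EuclideanSpace ℝ (Fin n)} : gauge K x ≤ r ↔ x ∈ r • K := by
  refine ⟨fun h => ?_, gauge_le_of_mem hr⟩
  rcases hr.eq_or_lt with rfl | hr
  · have hx : x = 0 := (gauge_eq_zero hK.absorbent
      (NormedSpace.isVonNBounded_of_isBounded ℝ hK.isCompact.isBounded)).1
      (le_antisymm h (gauge_nonneg x))
    exact ⟨0, mem_of_mem_nhds hK.mem_nhds_zero, by simp [hx]⟩
  · rw [Set.mem_smul_set_iff_inv_smul_mem₀ hr.ne', ← hK.isCompact.isClosed.closure_eq,
      ← gauge_le_one_iff_mem_closure hK.convex hK.mem_nhds_zero,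
      gauge_smul_of_nonneg (inv_nonneg.2 hr.le), smul_eq_mul, inv_mul_le_iff₀ hr]
    simpa using h

end IsSymmConvexBody

/-! ### Concentration on 2-convex bodies. -/

namespace IsTwoConvexWith

variable {n : ℕ} {K : Set (EuclideanSpace ℝ (Fin n))} {α : ℝ}

lemma gauge_midpoint_le (h : IsTwoConvexWith K α) (hK : IsSymmConvexBody K)
    {x y : EuclideanSpace ℝ (Fin n)} {ε : ℝ} (hε : 0 < ε) (hε2 : ε ≤ 2) (hx : gauge K x ≤ 1)
    (hy : gauge K y ≤ 1) (hxy : ε ≤ gauge K (x - y)) :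
    gauge K ((1 / 2 : ℝ) • (x + y)) ≤ 1 - α * ε ^ 2 := by
  have hle : modulusOfConvexity K ε ≤ 1 - gauge K ((1 / 2 : ℝ) • (x + y)) := by
    refine csInf_le ⟨0, ?_⟩ ⟨x, y, hx, hy, hxy, rfl⟩
    rintro r ⟨u, v, hu, hv, -, rfl⟩
    have := hK.gauge_add_le u v
    rw [gauge_smul_of_nonneg (by norm_num), smul_eq_mul]
    linarith
  linarith [h.le_modulus ε hε hε2]

/-- Concentration of linear functionals on a `2`-convex body. -/
lemma volume_inner_ge_le (h : IsTwoConvexWith K α) (hK : IsSymmConvexBody K)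
    {θ : EuclideanSpace ℝ (Fin n)} (hθ : ∀ x, inner ℝ θ x ≤ gauge K x) {t : ℝ} (ht : 0 < t) :
    volume {x ∈ K | t ≤ inner ℝ θ x} ≤
      ENNReal.ofReal (Real.exp (-(4 * n * α * t ^ 2))) * volume K := by
  set A := {x ∈ K | t ≤ inner ℝ θ x} with hA
  rcases A.eq_empty_or_nonempty with he | ⟨x₀, hx₀⟩
  · simp [he]
  have ht1 : t ≤ 1 := hx₀.2.trans ((hθ x₀).trans (gauge_le_one_of_mem hx₀.1))
  have hmid : ∀ x ∈ A, ∀ y ∈ -A, gauge K ((1 / 2 : ℝ) • (x + y)) ≤ 1 - α * (2 * t) ^ 2 := by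
    intro x hx y hy
    have hyK : y ∈ K := by simpa using hK.neg_mem hy.1
    refine h.gauge_midpoint_le hK (by positivity) (by linarith) (gauge_le_one_of_mem hx.1)
      (gauge_le_one_of_mem hyK) (le_trans ?_ (hθ _))
    have h1 := hx.2
    have h2 := hy.2
    rw [inner_neg_right] at h2
    rw [inner_sub_right]
    linarith
  set r := 1 - α * (2 * t) ^ 2 with hr
  -- Testing the midpoint bound on `x₀` and `-x₀` shows that the dilation factor is nonnegative.
  have hr0 : 0 ≤ r := (gauge_nonneg _).trans (hmid x₀ hx₀ (-x₀) (by simpa using hx₀))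
  have hcl : IsClosed {x | t ≤ inner ℝ θ x} := isClosed_le continuous_const (by fun_prop)
  have hAm : MeasurableSet A := hK.isCompact.measurableSet.inter hcl.measurableSet
  have hBM := volume_mul_volume_le_sq hAm hAm.neg (hK.isCompact.smul r).measurableSet
    fun x hx y hy => (hK.gauge_le_iff hr0).1 (hmid x hx y hy)
  rw [Measure.measure_neg, ← sq] at hBM
  have hle : volume A ≤ volume (r • K) := (ENNReal.pow_right_strictMono two_ne_zero).le_iff_le.1 hBM
  refine hle.trans ?_
  rw [Measure.addHaar_smul_of_nonneg _ hr0, finrank_euclideanSpace_fin]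
  gcongr
  calc r ^ n ≤ Real.exp (-(α * (2 * t) ^ 2)) ^ n := by
        gcongr
        exact Real.one_sub_le_exp_neg _
    _ = _ := by
        rw [← Real.exp_nat_mul]; congr 1; ring

/-- Layer cake with the cap bound at height `√t`, for `θ` and `-θ`: the tail `2 exp(-4nαt)`
integrates to `1/(2nα)`. -/
lemma lintegral_inner_sq_le (h : IsTwoConvexWith K α) (hK : IsSymmConvexBody K) (hn : 0 < n)
    {θ : EuclideanSpace ℝ (Fin n)} (hθ : ∀ x, inner ℝ θ x ≤ gauge K x) :
    ∫⁻ x in K, ENNReal.ofReal (inner ℝ θ x ^ 2) ≤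
      ENNReal.ofReal (1 / (2 * n * α)) * volume K := by
  have hα := h.const_pos
  have hn' : (0 : ℝ) < n := by exact_mod_cast hn
  have hθ' : ∀ x, inner ℝ (-θ) x ≤ gauge K x := fun x => by
    rw [inner_neg_left, ← inner_neg_right, ← hK.gauge_neg]
    exact hθ _
  set b : ℝ := 4 * n * α with hb
  have hb0 : 0 < b := by positivity
  have hcont : Continuous fun x => inner ℝ θ x ^ 2 := by fun_prop
  rw [lintegral_eq_lintegral_meas_le _ (Filter.Eventually.of_forall fun x => sq_nonneg _)
    hcont.measurable.aemeasurable]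
  calc ∫⁻ t in Set.Ioi (0 : ℝ), volume.restrict K {x | t ≤ inner ℝ θ x ^ 2}
      ≤ ∫⁻ t in Set.Ioi (0 : ℝ), ENNReal.ofReal (2 * Real.exp (-b * t)) * volume K := by
        refine setLIntegral_mono' measurableSet_Ioi fun t ht => ?_
        have ht0 : (0 : ℝ) < t := ht
        rw [Measure.restrict_apply' hK.isCompact.measurableSet]
        have hsub : {x | t ≤ inner ℝ θ x ^ 2} ∩ K ⊆
            {x ∈ K | √t ≤ inner ℝ θ x} ∪ {x ∈ K | √t ≤ inner ℝ (-θ) x} := by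
          rintro x ⟨hx, hxK⟩
          have hle : √t ≤ |inner ℝ θ x| := by
            rw [← Real.sqrt_sq_eq_abs]; exact Real.sqrt_le_sqrt hx
          rcases le_abs.1 hle with h1 | h1
          · exact Or.inl ⟨hxK, h1⟩
          · exact Or.inr ⟨hxK, by rwa [inner_neg_left]⟩
        refine (measure_mono hsub).trans ((measure_union_le _ _).trans ?_)
        refine (add_le_add (h.volume_inner_ge_le hK hθ (Real.sqrt_pos.2 ht0))
          (h.volume_inner_ge_le hK hθ' (Real.sqrt_pos.2 ht0))).trans ?_
        rw [Real.sq_sqrt ht0.le, ← add_mul, ← two_mul, ENNReal.ofReal_mul zero_le_two,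
          ENNReal.ofReal_ofNat, hb, neg_mul]
    _ = ENNReal.ofReal (1 / (2 * n * α)) * volume K := by
        rw [lintegral_mul_const' _ _ hK.volume_ne_top]
        congr 1
        rw [← ofReal_integral_eq_lintegral_ofReal
          ((integrableOn_exp_mul_Ioi (neg_neg_iff_pos.2 hb0) 0).const_mul 2)
          (Filter.Eventually.of_forall fun t => by positivity), integral_const_mul,
          integral_exp_mul_Ioi (neg_neg_iff_pos.2 hb0)]
        congr 1
        simp only [mul_zero, Real.exp_zero, hb]
        field_simp
        norm_num

/-- The second moment of a linear functional of dual norm at most `1` on a `2`-convex body. -/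
lemma integral_inner_sq_le (h : IsTwoConvexWith K α) (hK : IsSymmConvexBody K) (hn : 0 < n)
    {θ : EuclideanSpace ℝ (Fin n)} (hθ : ∀ x, inner ℝ θ x ≤ gauge K x) :
    ∫ x, inner ℝ θ x ^ 2 ∂(ProbabilityTheory.cond volume K) ≤ 1 / (2 * n * α) := by
  have hα := h.const_pos
  have hcont : Continuous fun x => inner ℝ θ x ^ 2 := by fun_prop
  rw [integral_eq_lintegral_of_nonneg_ae (Filter.Eventually.of_forall fun x => sq_nonneg _)
    hcont.aestronglyMeasurable]
  refine ENNReal.toReal_le_of_le_ofReal (by positivity) ?_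
  rw [ProbabilityTheory.cond, lintegral_smul_measure, smul_eq_mul]
  calc _ ≤ (volume K)⁻¹ * (ENNReal.ofReal (1 / (2 * n * α)) * volume K) := by
        gcongr; exact h.lintegral_inner_sq_le hK hn hθ
    _ = _ := by
        rw [mul_comm, mul_assoc, ENNReal.mul_inv_cancel hK.volume_ne_zero hK.volume_ne_top, mul_one]

/-- The constant of a `2`-convex body is at most `1 / 4`, and the dimension is positive. -/
lemma pos_and_le (h : IsTwoConvexWith K α) (hK : IsSymmConvexBody K) : 0 < n ∧ α ≤ 1 / 4 := by
  have hn : 0 < n := by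
    rcases Nat.eq_zero_or_pos n with rfl | hn
    -- In dimension `0` the infimum is over the empty set, so it takes the default value `0`,
    -- contradicting `α > 0`.
    · have h2 := h.le_modulus 2 two_pos le_rfl
      have : modulusOfConvexity K 2 = 0 := by
        rw [modulusOfConvexity, ← Real.sInf_empty]
        congr 1
        ext r
        simp only [Set.mem_ofPred_eq, Set.mem_empty_iff_false, iff_false]
        rintro ⟨x, y, -, -, hxy, -⟩
        rw [Subsingleton.elim (x - y) 0, gauge_zero] at hxy
        norm_num at hxy
      linarith [h.const_pos]
    · exact hn
  refine ⟨hn, ?_⟩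
  have : Nonempty (Fin n) := ⟨⟨0, hn⟩⟩
  obtain ⟨x, hx⟩ := exists_ne (0 : EuclideanSpace ℝ (Fin n))
  have hg : 0 < gauge K x := (gauge_pos hK.absorbent
      (NormedSpace.isVonNBounded_of_isBounded ℝ hK.isCompact.isBounded)).2 hx
  set u := (gauge K x)⁻¹ • x with hu
  have hgu : gauge K u = 1 := by
    rw [hu, gauge_smul_of_nonneg (inv_nonneg.2 hg.le), smul_eq_mul, inv_mul_cancel₀ hg.ne']
  -- Antipodal boundary points have midpoint `0`, so `0 ≤ 1 - 4α`.
  have := h.gauge_midpoint_le hK two_pos le_rfl hgu.le (y := -u) (by rw [hK.gauge_neg, hgu])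
    (by rw [sub_neg_eq_add, ← two_smul ℝ, gauge_smul_of_nonneg zero_le_two, hgu]; simp)
  rw [add_neg_cancel, smul_zero, gauge_zero] at this
  linarith

end IsTwoConvexWith
-- The covariance form of a convex body.
namespace IsConvexBody

variable {n : ℕ} {C : Set (EuclideanSpace ℝ (Fin n))}

lemma isProbabilityMeasure_cond (hC : IsConvexBody C) :
    IsProbabilityMeasure (ProbabilityTheory.cond volume C) :=
  ProbabilityTheory.cond_isProbabilityMeasure_of_finite hC.volume_ne_zero hC.volume_ne_top

lemma integrable_cond (hC : IsConvexBody C) {f : EuclideanSpace ℝ (Fin n) → ℝ}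
    (hf : Continuous f) : Integrable f (ProbabilityTheory.cond volume C) :=
  (hf.continuousOn.integrableOn_compact hC.isCompact).smul_measure
    (ENNReal.inv_ne_top.2 hC.volume_ne_zero)

/-- The second moment form of the uniform measure on a convex body. -/
noncomputable def covForm (hC : IsConvexBody C) :
    LinearMap.BilinForm ℝ (EuclideanSpace ℝ (Fin n)) :=
  LinearMap.mk₂ ℝ (fun θ η => ∫ x, inner ℝ θ x * inner ℝ η x ∂(ProbabilityTheory.cond volume C))
    (fun θ₁ θ₂ η => by
      rw [← integral_add (hC.integrable_cond (by fun_prop)) (hC.integrable_cond (by fun_prop))]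
      simp only [inner_add_left, add_mul])
    (fun c θ η => by
      simp only [real_inner_smul_left, mul_assoc, smul_eq_mul, integral_const_mul])
    (fun θ η₁ η₂ => by
      rw [← integral_add (hC.integrable_cond (by fun_prop)) (hC.integrable_cond (by fun_prop))]
      simp only [inner_add_left, mul_add])
    (fun c θ η => by
      simp only [real_inner_smul_left, mul_left_comm, smul_eq_mul, integral_const_mul])

lemma covForm_apply (hC : IsConvexBody C) (θ η : EuclideanSpace ℝ (Fin n)) :
    hC.covForm θ η =
      ∫ x, inner ℝ θ x * inner ℝ η x ∂(ProbabilityTheory.cond volume C) := rfl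

lemma covForm_self (hC : IsConvexBody C) (θ : EuclideanSpace ℝ (Fin n)) :
    hC.covForm θ θ = ∫ x, inner ℝ θ x ^ 2 ∂(ProbabilityTheory.cond volume C) := by
  simp only [covForm_apply, sq]

/-- A vanishing second moment would concentrate the uniform measure on the hyperplane `θ⊥`, which is
null. -/
lemma covForm_self_pos (hC : IsConvexBody C) {θ : EuclideanSpace ℝ (Fin n)} (hθ : θ ≠ 0) :
    0 < hC.covForm θ θ := by
  have := hC.isProbabilityMeasure_cond
  rw [covForm_self]
  refine lt_of_le_of_ne (integral_nonneg fun x => sq_nonneg _) fun h0 => ?_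
  have hae := (integral_eq_zero_iff_of_nonneg (fun x => sq_nonneg (inner ℝ θ x))
    (hC.integrable_cond (by fun_prop))).1 h0.symm
  have hker : volume ((LinearMap.ker (innerₛₗ ℝ θ) : Submodule ℝ (EuclideanSpace ℝ (Fin n))) :
      Set (EuclideanSpace ℝ (Fin n))) = 0 := by
    refine Measure.addHaar_submodule _ _ fun htop => hθ ?_
    have : θ ∈ LinearMap.ker (innerₛₗ ℝ θ) := htop ▸ Submodule.mem_top
    simpa using this
  have h1 : ProbabilityTheory.cond volume C (LinearMap.ker (innerₛₗ ℝ θ) :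
      Submodule ℝ (EuclideanSpace ℝ (Fin n))) = 0 :=
    ProbabilityTheory.cond_absolutelyContinuous hker
  have h2 : ∀ᵐ x ∂(ProbabilityTheory.cond volume C), False := by
    filter_upwards [hae, measure_eq_zero_iff_ae_notMem.1 h1] with x hx hx'
    exact hx' (by simpa using hx)
  simp [hC.volume_ne_zero, hC.volume_ne_top] at h2

lemma exists_orthonormal_basis (hC : IsConvexBody C) :
    ∃ v : Module.Basis (Fin n) ℝ (EuclideanSpace ℝ (Fin n)),
      ∀ i j, hC.covForm (v i) (v j) = if i = j then 1 else 0 := by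
  have hsymm : LinearMap.IsSymm hC.covForm := ⟨fun θ η => by simp [covForm_apply, mul_comm]⟩
  obtain ⟨u, hu⟩ := LinearMap.BilinForm.exists_orthogonal_basis hsymm
  have hpos : ∀ i, 0 < hC.covForm (u i) (u i) := fun i => hC.covForm_self_pos (u.ne_zero i)
  have hd : Module.finrank ℝ (EuclideanSpace ℝ (Fin n)) = n := finrank_euclideanSpace_fin
  refine ⟨(u.isUnitSMul (w := fun i => (√(hC.covForm (u i) (u i)))⁻¹)
    fun i => (inv_pos.2 (Real.sqrt_pos.2 (hpos i))).ne'.isUnit).reindex (finCongr hd), fun i j => ?_⟩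
  simp only [Module.Basis.reindex_apply, Module.Basis.isUnitSMul_apply, map_smul,
    LinearMap.smul_apply, smul_eq_mul]
  rcases eq_or_ne i j with rfl | hij
  · set k := (finCongr hd).symm i
    rw [if_pos rfl, ← mul_assoc, ← mul_inv, Real.mul_self_sqrt (hpos k).le,
      inv_mul_cancel₀ (hpos k).ne']
  · rw [if_neg hij, LinearMap.isOrthoᵢ_def.1 hu _ _ (fun e => hij ((finCongr hd).symm.injective e))]
    simp

end IsConvexBody

/-! ### Duality and comparison of the gauge with a Euclidean norm. -/

lemma IsSymmConvexBody.exists_inner_eq_gauge {n : ℕ} {K : Set (EuclideanSpace ℝ (Fin n))}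
    (hK : IsSymmConvexBody K) (x : EuclideanSpace ℝ (Fin n)) :
    ∃ θ, inner ℝ θ x = gauge K x ∧ ∀ y, inner ℝ θ y ≤ gauge K y := by
  rcases eq_or_ne x 0 with rfl | hx
  · exact ⟨0, by simp, fun y => by simpa using gauge_nonneg y⟩
  -- Hahn–Banach: extend `c • x ↦ c * gauge K x` from the line, dominated by the gauge.
  obtain ⟨g, hg, hg'⟩ := exists_extension_of_le_sublinear
    (LinearPMap.mkSpanSingleton x (gauge K x) hx) (gauge K)
    (fun c hc y => by rw [gauge_smul_of_nonneg hc.le, smul_eq_mul]) hK.gauge_add_le (by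
      rintro ⟨y, hy⟩
      obtain ⟨c, rfl⟩ := Submodule.mem_span_singleton.1 hy
      rw [LinearPMap.mkSpanSingleton'_apply]
      simp only [RingHom.id_apply, smul_eq_mul]
      rcases le_total 0 c with hc | hc
      · rw [gauge_smul_of_nonneg hc, smul_eq_mul]
      · exact (mul_nonpos_of_nonpos_of_nonneg hc (gauge_nonneg x)).trans (gauge_nonneg _))
  refine ⟨(InnerProductSpace.toDual ℝ _).symm (LinearMap.toContinuousLinearMap g), ?_, fun y => ?_⟩
  · rw [InnerProductSpace.toDual_symm_apply]
    exact (hg ⟨x, Submodule.mem_span_singleton_self x⟩).trans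
      (LinearPMap.mkSpanSingleton_apply ℝ ℝ hx _)
  · rw [InnerProductSpace.toDual_symm_apply]
    exact hg' y

/-- In coordinates in which the uniform measure on a `2`-convex body has covariance identity,
the body contains a Euclidean ball of radius comparable to `√(n α)`. -/
lemma IsTwoConvexWith.gauge_sq_le {n : ℕ} {K : Set (EuclideanSpace ℝ (Fin n))} {α : ℝ}
    (h : IsTwoConvexWith K α) (hK : IsSymmConvexBody K)
    {v : Module.Basis (Fin n) ℝ (EuclideanSpace ℝ (Fin n))}
    (hv : ∀ i j, hK.toIsConvexBody.covForm (v i) (v j) = if i = j then 1 else 0)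
    (x : EuclideanSpace ℝ (Fin n)) :
    gauge K x ^ 2 ≤ 1 / (2 * n * α) * ∑ i, inner ℝ (v i) x ^ 2 := by
  obtain ⟨θ, hθx, hθ⟩ := hK.exists_inner_eq_gauge x
  have hm := h.integral_inner_sq_le hK (h.pos_and_le hK).1 hθ
  -- The second moment of the norming functional is the sum of its squared coordinates in `v`;
  -- Cauchy–Schwarz finishes.
  rw [← hK.toIsConvexBody.covForm_self, ← v.sum_repr θ] at hm
  simp only [map_sum, map_smul, LinearMap.sum_apply, LinearMap.smul_apply, hv, smul_eq_mul,
    mul_ite, mul_one, mul_zero, Finset.sum_ite_eq', Finset.mem_univ,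
    if_true] at hm
  have hx : gauge K x = ∑ i, v.repr θ i * inner ℝ (v i) x := by
    rw [← hθx]
    conv_lhs => rw [← v.sum_repr θ]
    simp only [sum_inner, real_inner_smul_left]
  rw [hx]
  refine (Finset.sum_mul_sq_le_sq_mul_sq _ _ _).trans ?_
  gcongr
  simpa only [sq] using hm
-- Averages over independent points.
section Average

variable {n s : ℕ} {C K : Set (EuclideanSpace ℝ (Fin n))}

lemma IsConvexBody.pi_cond_eq (hC : IsConvexBody C) (s : ℕ) :
    Measure.pi (fun _ : Fin s => ProbabilityTheory.cond volume C) =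
      (∏ _j : Fin s, volume C)⁻¹ • volume.restrict (Set.univ.pi fun _ : Fin s => C) := by
  have := hC.isProbabilityMeasure_cond
  refine Measure.pi_eq fun S hS => ?_
  rw [volume_pi, Measure.restrict_pi_pi, Measure.smul_apply, Measure.pi_pi, smul_eq_mul,
    ENNReal.prod_inv_distrib, ← Finset.prod_mul_distrib]
  · rfl
  · exact fun i _ j _ _ => Or.inl hC.volume_ne_zero

lemma IsConvexBody.integrable_pi_cond (hC : IsConvexBody C)
    {f : (Fin s → EuclideanSpace ℝ (Fin n)) → ℝ} (hf : Continuous f) :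
    Integrable f (Measure.pi (fun _ : Fin s => ProbabilityTheory.cond volume C)) := by
  rw [hC.pi_cond_eq]
  refine (hf.continuousOn.integrableOn_compact
    (isCompact_univ_pi fun _ => hC.isCompact)).smul_measure (ENNReal.inv_ne_top.2 ?_)
  exact Finset.prod_ne_zero_iff.2 fun _ _ => hC.volume_ne_zero

lemma IsConvexBody.bodyNorm_eq (hC : IsConvexBody C) (K : Set (EuclideanSpace ℝ (Fin n)))
    (t : EuclideanSpace ℝ (Fin s)) :
    bodyNorm (fun _ => C) K t = ∫ x, gauge K (∑ j, t j • x j)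
      ∂(Measure.pi (fun _ : Fin s => ProbabilityTheory.cond volume C)) := by
  rw [hC.pi_cond_eq, integral_smul_measure, bodyNorm, ENNReal.toReal_inv, ENNReal.toReal_prod,
    smul_eq_mul]
  rfl

/-- The second moment of a linear functional of a weighted sum of independent points of a centred
convex body. -/
lemma IsConvexBody.integral_inner_sum_sq (hC : IsConvexBody C) {θ : EuclideanSpace ℝ (Fin n)}
    (hmean : ∫ x, inner ℝ θ x ∂(ProbabilityTheory.cond volume C) = 0)
    (t : EuclideanSpace ℝ (Fin s)) :
    ∫ x, inner ℝ θ (∑ j, t j • x j) ^ 2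
      ∂(Measure.pi (fun _ : Fin s => ProbabilityTheory.cond volume C)) =
      ‖t‖ ^ 2 * hC.covForm θ θ := by
  have := hC.isProbabilityMeasure_cond
  set ν := ProbabilityTheory.cond volume C with hν
  let X : Fin s → EuclideanSpace ℝ (Fin n) → ℝ := fun j x => t j * inner ℝ θ x
  have hX : ∀ j, Continuous (X j) := fun j => by fun_prop
  have hX2 : ∀ j, MemLp (X j) 2 ν := fun j =>
    (memLp_two_iff_integrable_sq (hX j).aestronglyMeasurable).2
      (hC.integrable_cond ((hX j).pow 2))
  have hX0 : ∀ j, ∫ x, X j x ∂ν = 0 := fun j => by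
    simp only [X, integral_const_mul, hmean, mul_zero]
  have key := ProbabilityTheory.variance_sum_pi (μ := fun _ : Fin s => ν) hX2
  have hsum : (∑ j, fun x : Fin s → EuclideanSpace ℝ (Fin n) => X j (x j)) =
      fun x => inner ℝ θ (∑ j, t j • x j) := by
    ext x
    simp only [Finset.sum_apply, X, inner_sum, real_inner_smul_right]
  have hmean' : ∫ x, inner ℝ θ (∑ j, t j • x j) ∂(Measure.pi fun _ : Fin s => ν) = 0 := by
    simp only [inner_sum, real_inner_smul_right]
    rw [integral_finsetSum _ fun j _ => hC.integrable_pi_cond (by fun_prop)]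
    refine Finset.sum_eq_zero fun j _ => ?_
    rw [integral_comp_eval (μ := fun _ : Fin s => ν) (f := X j) (hX j).aestronglyMeasurable]
    exact hX0 j
  rw [hsum, ProbabilityTheory.variance_of_integral_eq_zero
    (Continuous.aemeasurable (by fun_prop)) hmean'] at key
  rw [key, EuclideanSpace.norm_sq_eq, Finset.sum_mul]
  refine Finset.sum_congr rfl fun j _ => ?_
  rw [ProbabilityTheory.variance_of_integral_eq_zero (hX j).measurable.aemeasurable (hX0 j)]
  simp only [X, mul_pow, integral_const_mul, Real.norm_eq_abs, sq_abs, hC.covForm_self, hν]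

lemma IsTwoConvexWith.bodyNorm_sq_le {α M : ℝ} (h : IsTwoConvexWith K α)
    (hK : IsSymmConvexBody K) (hC : IsConvexBody C)
    (hmean : ∀ θ, ∫ x, inner ℝ θ x ∂(ProbabilityTheory.cond volume C) = 0)
    {v : Module.Basis (Fin n) ℝ (EuclideanSpace ℝ (Fin n))}
    (hv : ∀ i j, hK.toIsConvexBody.covForm (v i) (v j) = if i = j then 1 else 0)
    (hM : ∀ i, hC.covForm (v i) (v i) ≤ M) (t : EuclideanSpace ℝ (Fin s)) :
    bodyNorm (fun _ => C) K t ^ 2 ≤ M / (2 * α) * ‖t‖ ^ 2 := by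
  have := hC.isProbabilityMeasure_cond
  have hα := h.const_pos
  have hn : (0 : ℝ) < n := by exact_mod_cast (h.pos_and_le hK).1
  rw [hC.bodyNorm_eq]
  set P := Measure.pi (fun _ : Fin s => ProbabilityTheory.cond volume C)
  have hG : Continuous fun x : Fin s → EuclideanSpace ℝ (Fin n) => gauge K (∑ j, t j • x j) :=
    hK.continuous_gauge.comp (by fun_prop)
  have hG2 := hC.integrable_pi_cond (hG.pow 2)
  -- Nonnegative variance gives `(E G)² ≤ E G²`, so second moments suffice.
  have hvar := ProbabilityTheory.variance_nonneg (fun x => gauge K (∑ j, t j • x j)) P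
  rw [ProbabilityTheory.variance_eq_sub
    ((memLp_two_iff_integrable_sq hG.aestronglyMeasurable).2 hG2), sub_nonneg] at hvar
  refine hvar.trans ?_
  calc ∫ x, gauge K (∑ j, t j • x j) ^ 2 ∂P
      ≤ ∫ x, 1 / (2 * n * α) * ∑ i, inner ℝ (v i) (∑ j, t j • x j) ^ 2 ∂P :=
        integral_mono hG2 (hC.integrable_pi_cond (by fun_prop)) fun x => h.gauge_sq_le hK hv _
    _ = 1 / (2 * n * α) * ∑ i, ‖t‖ ^ 2 * hC.covForm (v i) (v i) := by
        rw [integral_const_mul, integral_finsetSum _ fun i _ => hC.integrable_pi_cond (by fun_prop)]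
        simp only [hC.integral_inner_sum_sq (hmean _)]
    _ ≤ 1 / (2 * n * α) * ∑ _i : Fin n, ‖t‖ ^ 2 * M := by
        gcongr with i
        exact hM i
    _ = M / (2 * α) * ‖t‖ ^ 2 := by
        simp only [Finset.sum_const, Finset.card_univ, Fintype.card_fin, nsmul_eq_mul]
        field_simp

end Average

lemma IsSymmConvexBody.integral_inner_eq_zero {n : ℕ} {K : Set (EuclideanSpace ℝ (Fin n))}
    (hK : IsSymmConvexBody K) (θ : EuclideanSpace ℝ (Fin n)) :
    ∫ x, inner ℝ θ x ∂(ProbabilityTheory.cond volume K) = 0 := by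
  rw [ProbabilityTheory.cond, integral_smul_measure,
    ← integral_indicator hK.isCompact.measurableSet]
  have h1 := integral_neg_eq_self (K.indicator fun x => inner ℝ θ x) volume
  have h2 : ∀ x, K.indicator (fun x => inner ℝ θ x) (-x) = -K.indicator (fun x => inner ℝ θ x) x := by
    intro x
    by_cases hx : x ∈ K
    · rw [Set.indicator_of_mem hx, Set.indicator_of_mem (hK.neg_mem hx), inner_neg_right]
    · have hx' : -x ∉ K := fun h => hx (by simpa using hK.neg_mem h)
      rw [Set.indicator_of_notMem hx, Set.indicator_of_notMem hx', neg_zero]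
  simp only [h2, integral_neg] at h1
  rw [show ∫ x, K.indicator (fun x => inner ℝ θ x) x = 0 by linarith, smul_zero]

/-! ### Isotropic bodies and the lower bound for the isotropic constant. -/

namespace IsIsotropicWith

variable {n : ℕ} {C : Set (EuclideanSpace ℝ (Fin n))} {L : ℝ}

lemma cond_eq (h : IsIsotropicWith C L) :
    ProbabilityTheory.cond volume C = volume.restrict C := by
  rw [ProbabilityTheory.cond, h.volume_eq_one, inv_one, one_smul]

lemma integral_inner_eq_zero (h : IsIsotropicWith C L) (θ : EuclideanSpace ℝ (Fin n)) :
    ∫ x, inner ℝ θ x ∂(ProbabilityTheory.cond volume C) = 0 := by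
  rw [h.cond_eq, integral_inner (f := fun x => x)
    (continuous_id.continuousOn.integrableOn_compact h.isCompact), h.barycenter_eq_zero,
    inner_zero_right]

lemma covForm_self (h : IsIsotropicWith C L) (θ : EuclideanSpace ℝ (Fin n)) :
    h.toIsConvexBody.covForm θ θ = L ^ 2 * ‖θ‖ ^ 2 := by
  rcases eq_or_ne θ 0 with rfl | hθ
  · simp
  have hθ' : ‖θ‖ ≠ 0 := norm_ne_zero_iff.2 hθ
  have hu := h.integral_inner_sq (‖θ‖⁻¹ • θ) (norm_smul_inv_norm (𝕜 := ℝ) hθ)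
  simp only [real_inner_smul_right, mul_pow, integral_const_mul] at hu
  simp only [IsConvexBody.covForm_self, h.cond_eq, ← hu, real_inner_comm θ]
  field_simp

/-- The isotropic constant is bounded below by an absolute constant. -/
lemma one_le_const_sq (h : IsIsotropicWith C L) (hn : 0 < n) :
    1 ≤ 2 * (Real.pi * Real.exp 1) * L ^ 2 := by
  have hn' : (0 : ℝ) < n := by exact_mod_cast hn
  -- Compare `∫ exp(-b‖x‖²)` over `C` with its value `(π/b)^(n/2)` over the whole space; `b = πe`
  -- optimises the resulting bound.
  set b := Real.pi * Real.exp 1 with hb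
  have hb0 : 0 < b := by positivity
  have hvol : volume.real C = 1 := by simp [measureReal_def, h.volume_eq_one]
  have hint : ∀ f : EuclideanSpace ℝ (Fin n) → ℝ, Continuous f → IntegrableOn f C := fun f hf =>
    hf.continuousOn.integrableOn_compact h.isCompact
  have hnorm : ∫ x in C, ‖x‖ ^ 2 = n * L ^ 2 := by
    have hexp : ∀ x : EuclideanSpace ℝ (Fin n),
        ‖x‖ ^ 2 = ∑ i, inner ℝ (EuclideanSpace.basisFun (Fin n) ℝ i) x ^ 2 := fun x => by
      simpa using ((EuclideanSpace.basisFun (Fin n) ℝ).sum_sq_norm_inner_right x).symm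
    simp only [hexp]
    rw [integral_finsetSum _ fun i _ => hint _ (by fun_prop)]
    have hi : ∀ i, ∫ x in C, inner ℝ (EuclideanSpace.basisFun (Fin n) ℝ i) x ^ 2 = L ^ 2 := by
      intro i
      have := h.covForm_self (EuclideanSpace.basisFun (Fin n) ℝ i)
      rw [IsConvexBody.covForm_self, h.cond_eq] at this
      simpa using this
    simp only [hi, Finset.sum_const, Finset.card_univ, Fintype.card_fin, nsmul_eq_mul]
  set m := b * (n * L ^ 2) with hm
  have hgauss : ∫ x : EuclideanSpace ℝ (Fin n), Real.exp (-b * ‖x‖ ^ 2) = Real.exp (-(n / 2)) := by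
    rw [GaussianFourier.integral_rexp_neg_mul_sq_norm hb0, finrank_euclideanSpace_fin,
      show Real.pi / b = Real.exp (-1) by
        rw [hb, Real.exp_neg]; field_simp,
      ← Real.exp_mul]
    congr 1; ring
  have hgi : Integrable fun x : EuclideanSpace ℝ (Fin n) => Real.exp (-b * ‖x‖ ^ 2) := by
    by_contra hni
    rw [integral_undef hni] at hgauss
    exact (Real.exp_pos _).ne hgauss
  have hup : ∫ x in C, Real.exp (-b * ‖x‖ ^ 2) ≤ Real.exp (-(n / 2)) := by
    rw [← hgauss]
    exact setIntegral_le_integral hgi (Filter.Eventually.of_forall fun x => (Real.exp_pos _).le)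
  -- Jensen's inequality, through the tangent line of `exp` at the mean `-m` of `-b‖x‖²`.
  have hlow : Real.exp (-m) ≤ ∫ x in C, Real.exp (-b * ‖x‖ ^ 2) := by
    calc Real.exp (-m) = ∫ x in C, Real.exp (-m) * (1 + m - b * ‖x‖ ^ 2) := by
          rw [integral_const_mul, integral_sub (hint _ continuous_const) (hint _ (by fun_prop)),
            integral_const_mul, hnorm, setIntegral_const, hvol, ← hm]
          simp
      _ ≤ _ := by
          refine setIntegral_mono (hint _ (by fun_prop)) hgi.integrableOn fun x => ?_
          have := Real.add_one_le_exp (m - b * ‖x‖ ^ 2)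
          calc Real.exp (-m) * (1 + m - b * ‖x‖ ^ 2)
              ≤ Real.exp (-m) * Real.exp (m - b * ‖x‖ ^ 2) := by gcongr; linarith
            _ = _ := by rw [← Real.exp_add]; congr 1; ring
  have hle := Real.exp_le_exp.1 (hlow.trans hup)
  have : n * 1 ≤ n * (2 * b * L ^ 2) := by rw [hm] at hle; linarith
  exact le_of_mul_le_mul_left this hn'

end IsIsotropicWith

/-! ### The two bounds. -/

theorem mainTheorem7 :
    ∃ c : ℝ, 0 < c ∧
      (∀ (n : ℕ) (C K : Set (EuclideanSpace ℝ (Fin n))) (L α : ℝ),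
        IsIsotropicWith C L → IsIsotropic K → IsSymmConvexBody K → IsTwoConvexWith K α →
        ∀ (s : ℕ), 1 ≤ s → ∀ t : EuclideanSpace ℝ (Fin s),
          bodyNorm (fun _ => C) K t ≤ c * L / Real.sqrt α * ‖t‖) ∧
      (∀ (n : ℕ) (K : Set (EuclideanSpace ℝ (Fin n))) (α : ℝ),
        IsSymmConvexBody K → IsTwoConvexWith K α →
        ∀ (s : ℕ), 1 ≤ s → ∀ t : EuclideanSpace ℝ (Fin s),
          bodyNorm (fun _ => K) K t ≤ c / α * ‖t‖) := by
  refine ⟨3, by norm_num, ?_, ?_⟩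
  · rintro n C K L α hC ⟨LK, hKiso⟩ hK h s - t
    have hα := h.const_pos
    have hL := hC.const_pos
    have hLK := hKiso.const_pos
    obtain ⟨v, hv⟩ := hK.toIsConvexBody.exists_orthonormal_basis
    -- Here `‖v i‖² = LK⁻² ≤ 2πe ≤ 18`; then `18 / (2α) = 3² / α` accounts for the constant `3`.
    have hM : ∀ i, hC.toIsConvexBody.covForm (v i) (v i) ≤ 18 * L ^ 2 := by
      intro i
      have h1 : LK ^ 2 * ‖v i‖ ^ 2 = 1 := by
        rw [← hKiso.covForm_self, hv, if_pos rfl]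
      have h2 := hKiso.one_le_const_sq (h.pos_and_le hK).1
      have h3 : Real.pi * Real.exp 1 ≤ 9 := by
        have := Real.pi_lt_d2
        have := Real.exp_one_lt_d9
        nlinarith [Real.pi_pos, Real.exp_pos 1]
      have h4 : ‖v i‖ ^ 2 ≤ 18 := by
        calc ‖v i‖ ^ 2 = 1 * ‖v i‖ ^ 2 := (one_mul _).symm
          _ ≤ (2 * 9 * LK ^ 2) * ‖v i‖ ^ 2 := by
              gcongr
              exact h2.trans (by gcongr)
          _ = 18 := by rw [mul_assoc, h1]; norm_num
      rw [hC.covForm_self, mul_comm]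
      gcongr
    have key := h.bodyNorm_sq_le hK hC.toIsConvexBody hC.integral_inner_eq_zero hv hM t
    refine le_of_sq_le_sq (key.trans_eq ?_) (by positivity)
    rw [mul_pow, div_pow, mul_pow, Real.sq_sqrt hα.le]
    ring
  · rintro n K α hK h s - t
    have hα := h.const_pos
    have hα' := (h.pos_and_le hK).2
    obtain ⟨v, hv⟩ := hK.toIsConvexBody.exists_orthonormal_basis
    have key := h.bodyNorm_sq_le hK hK.toIsConvexBody hK.integral_inner_eq_zero hv
      (fun i => ((hv i i).trans (if_pos rfl)).le) t
    refine le_of_sq_le_sq (key.trans ?_) (by positivity)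
    rw [mul_pow]
    gcongr
    -- Only `1 / (2α) ≤ 9 / α²` remains, which `α ≤ 1/4` more than ensures.
    rw [div_pow, div_le_div_iff₀ (by positivity) (by positivity)]
    nlinarith
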